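/- Let $g\ge 3$ be an odd integer and let $G$ be a finite simple graph on $n$ vertices whose girth is at least $g-1$ (the girth of a graph without cycles is $\infty$). For $m\ge 1$, let $P(G,m)$ be the number of proper $m$-colorings of $G$. A cover of $G$ is a triple $\mathcal H=(L,H,M)$, where $L$ assigns to the vertices of $G$ pairwise disjoint nonempty finite sets, $H$ is a simple graph with vertex set $\bigcup_{v\in V(G)}L(v)$, and $M$ assigns to each edge $uv$ of $G$ a matching $M(uv)$ each of whose edges joins $L(u)$ to $L(v)$, such that each $L(u)$ is a clique of $H$ and, for distinct vertices $u,v$, the set of edges of $H$ between $L(u)$ and $L(v)$ is $M(uv)$ if $uv\in E(G)$ and is empty otherwise. It is a full $m$-fold cover if $|L(u)|=m$ for every vertex $u$ and $|M(uv)|=m$ for every edge $uv$ of $G$. Let $P_{DP}(G,\mathcal H)$ be the number of independent sets of $H$ of size $n$, and let $P^*_{DP}(G,m)$ be the maximum of $P_{DP}(G,\mathcal H)$ over all full $m$-fold covers $\mathcal H$ of $G$. Then $$P^*_{DP}(G,m)-P(G,m)=O\left(m^{\,n-g+1}\right)\qquad\text{as } m\to\infty .$$ -/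

import Mathlib

open Filter Asymptotics

universe u

/-- The number of proper `m`-colorings of `G`, i.e. the value `P(G, m)` of the chromatic
polynomial. -/
noncomputable def chromaticCount {V : Type u} (G : SimpleGraph V) (m : ℕ) : ℕ :=
  Nat.card (G.Coloring (Fin m))

/-- The set of edges of `H` with one endpoint in `A` and the other one in `B`. -/
def edgesBetween {W : Type u} (H : SimpleGraph W) (A B : Finset W) : Set (Sym2 W) :=
  {x | ∃ a ∈ A, ∃ b ∈ B, H.Adj a b ∧ x = s(a, b)}

/-- A cover `(L, H, M)` of a simple graph `G`. The vertices of `H` are the elements of `W`; as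
`G` is simple, so is `H`. -/
structure DPCover {V : Type u} (G : SimpleGraph V) (W : Type u) where
  /-- the lists -/
  L : V → Finset W
  /-- the cover graph -/
  H : SimpleGraph W
  /-- the matchings -/
  M : G.edgeSet → Set (Sym2 W)
  L_nonempty : ∀ u, (L u).Nonempty
  /-- the vertex set of `H` is the union of the lists -/
  L_covers : ∀ w : W, ∃ u, w ∈ L u
  /-- each `M e` is a matching: two of its edges that share a vertex are equal -/
  M_matching : ∀ e, ∀ x ∈ M e, ∀ y ∈ M e, ∀ w : W, w ∈ x → w ∈ y → x = y
  M_ends : ∀ (u v : V) (h : s(u, v) ∈ G.edgeSet),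
    M ⟨s(u, v), h⟩ ⊆ {x | ∃ a ∈ L u, ∃ b ∈ L v, x = s(a, b)}
  L_disjoint : ∀ u v, u ≠ v → Disjoint (L u) (L v)
  L_clique : ∀ u, H.IsClique (L u : Set W)
  M_disjoint : ∀ e₁ e₂, e₁ ≠ e₂ → Disjoint (M e₁) (M e₂)
  /-- for distinct `u, v`, the edges of `H` between `L u` and `L v` are those of `M (uv)` if `uv`
  is an edge of `G`, and there are none otherwise -/
  edges_eq : ∀ u v, u ≠ v →
    edgesBetween H (L u) (L v) = ⋃ h : s(u, v) ∈ G.edgeSet, M ⟨s(u, v), h⟩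

namespace DPCover

/-- The `𝓗`-colorings of `G`: independent sets of `H` of size `|V(G)|`. -/
def colorings {V W : Type u} [Fintype V] {G : SimpleGraph V} (C : DPCover G W) :
    Set (Finset W) :=
  {I | C.H.IsIndepSet (I : Set W) ∧ I.card = Fintype.card V}

/-- The number `P_DP(G, 𝓗)` of `𝓗`-colorings of `G`. -/
noncomputable def count {V W : Type u} [Fintype V] {G : SimpleGraph V} (C : DPCover G W) : ℕ :=
  C.colorings.ncard

/-- A full `m`-fold cover: every list has `m` elements, and there are exactly `m` edges between
the lists of two adjacent vertices (and none between those of distinct non-adjacent ones). -/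
def IsFull {V W : Type u} {G : SimpleGraph V} (C : DPCover G W) (m : ℕ) : Prop :=
  (∀ u, (C.L u).card = m) ∧
    (∀ u v, G.Adj u v → (edgesBetween C.H (C.L u) (C.L v)).ncard = m) ∧
    ∀ u v, u ≠ v → ¬ G.Adj u v → (edgesBetween C.H (C.L u) (C.L v)).ncard = 0

end DPCover

/-- The numbers `P_DP(G, 𝓗)`, for `𝓗` a full `m`-fold cover of `G`. -/
def fullCoverCounts {V : Type u} [Fintype V] (G : SimpleGraph V) (m : ℕ) : Set ℕ :=
  {k | ∃ (W : Type u) (C : DPCover G W), C.IsFull m ∧ C.count = k}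

/-- The dual DP color function `P*_DP(G, m)`: the maximum of `P_DP(G, 𝓗)` over all full `m`-fold
covers `𝓗` of `G`. That the supremum is a maximum for `m ≥ 1` is `dualDPColor_isGreatest`. -/
noncomputable def dualDPColor {V : Type u} [Fintype V] (G : SimpleGraph V) (m : ℕ) : ℕ :=
  sSup (fullCoverCounts G m)

/-- The cover of `G` with lists `{u} × [m]` whose matchings join equal colors. -/
def canonicalCover {V : Type u} (G : SimpleGraph V) (m : ℕ) (hm : 0 < m) :
    DPCover G (V × Fin m) where
  L u := ({u} : Finset V) ×ˢ Finset.univ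
  H :=
    { Adj := fun p q => (p.1 = q.1 ∧ p.2 ≠ q.2) ∨ (G.Adj p.1 q.1 ∧ p.2 = q.2)
      symm := ⟨fun p q h => by
        rcases h with h | h
        · exact Or.inl ⟨h.1.symm, h.2.symm⟩
        · exact Or.inr ⟨h.1.symm, h.2.symm⟩⟩
      loopless := ⟨fun p h => by
        rcases h with h | h
        · exact h.2 rfl
        · exact G.loopless.irrefl _ h.1⟩ }
  M e := {x | ∃ u v i, e.1 = s(u, v) ∧ x = s((u, i), (v, i))}
  L_nonempty u := ⟨(u, ⟨0, hm⟩), by simp⟩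
  L_covers w := ⟨w.1, by simp⟩
  M_matching := by
    rintro ⟨e, he⟩ x ⟨u, v, i, h1, rfl⟩ y ⟨u', v', j, h2, rfl⟩ w hw hw'
    have h3 : s(u, v) = s(u', v') := h1.symm.trans h2
    simp only [Sym2.mem_iff] at hw hw'
    have hij : i = j := by
      rcases hw with rfl | rfl <;> rcases hw' with h | h <;> exact congrArg Prod.snd h
    subst hij
    rcases Sym2.eq_iff.1 h3 with ⟨rfl, rfl⟩ | ⟨rfl, rfl⟩
    · rfl
    · exact Sym2.eq_swap
  M_ends := by
    rintro u v h x ⟨u', v', i, h1, rfl⟩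
    rcases Sym2.eq_iff.1 h1 with ⟨rfl, rfl⟩ | ⟨rfl, rfl⟩
    · exact ⟨(u, i), by simp, (v, i), by simp, rfl⟩
    · exact ⟨(u, i), by simp, (v, i), by simp, Sym2.eq_swap⟩
  L_disjoint u v h := by
    rw [Finset.disjoint_left]
    rintro ⟨a, i⟩ h1 h2
    simp only [Finset.mem_product, Finset.mem_singleton, Finset.mem_univ, and_true] at h1 h2
    exact h (h1.symm.trans h2)
  L_clique u := by
    rintro ⟨a, i⟩ h1 ⟨b, j⟩ h2 hne
    simp only [Finset.mem_coe, Finset.mem_product, Finset.mem_singleton, Finset.mem_univ,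
      and_true] at h1 h2
    subst h1 h2
    exact Or.inl ⟨rfl, fun h => hne (Prod.ext rfl h)⟩
  M_disjoint := by
    rintro ⟨e₁, h₁⟩ ⟨e₂, h₂⟩ hne
    rw [Set.disjoint_left]
    rintro x ⟨u, v, i, h1, rfl⟩ ⟨u', v', j, h2, h3⟩
    apply hne
    apply Subtype.ext
    have h4 := congrArg (Sym2.map Prod.fst) h3
    simp only [Sym2.map_mk] at h4
    exact (h1.trans h4).trans h2.symm
  edges_eq := by
    intro u v huv
    ext x
    simp only [edgesBetween, Set.mem_iUnion, Set.mem_setOf_eq, Finset.mem_product,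
      Finset.mem_singleton, Finset.mem_univ, and_true]
    constructor
    · rintro ⟨⟨a, i⟩, rfl, ⟨b, j⟩, rfl, h | h, rfl⟩
      · exact absurd h.1 huv
      · obtain ⟨h1, h2⟩ := h
        simp only at h1 h2
        subst h2
        exact ⟨h1, _, _, i, rfl, rfl⟩
    · rintro ⟨h, u', v', i, h1, rfl⟩
      have hadj : G.Adj u v := h
      rcases Sym2.eq_iff.1 h1 with ⟨rfl, rfl⟩ | ⟨rfl, rfl⟩
      · exact ⟨(u, i), rfl, (v, i), rfl, Or.inr ⟨hadj, rfl⟩, rfl⟩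
      · exact ⟨(u, i), rfl, (v, i), rfl, Or.inr ⟨hadj, rfl⟩, Sym2.eq_swap⟩

theorem canonicalCover_isFull {V : Type u} (G : SimpleGraph V) (m : ℕ) (hm : 0 < m) :
    (canonicalCover G m hm).IsFull m := by
  have key : ∀ u v, u ≠ v → edgesBetween (canonicalCover G m hm).H ((canonicalCover G m hm).L u)
      ((canonicalCover G m hm).L v) =
        {x | G.Adj u v ∧ ∃ i : Fin m, s((u, i), (v, i)) = x} := by
    intro u v huv
    ext x
    simp only [edgesBetween, canonicalCover, Set.mem_setOf_eq, Finset.mem_product,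
      Finset.mem_singleton, Finset.mem_univ, and_true]
    constructor
    · rintro ⟨⟨a, i⟩, rfl, ⟨b, j⟩, rfl, h | h, rfl⟩
      · exact absurd h.1 huv
      · obtain ⟨h1, h2⟩ := h
        simp only at h1 h2
        subst h2
        exact ⟨h1, i, rfl⟩
    · rintro ⟨h, i, rfl⟩
      exact ⟨(u, i), rfl, (v, i), rfl, Or.inr ⟨h, rfl⟩, rfl⟩
  refine ⟨fun u => by simp [canonicalCover], fun u v h => ?_, fun u v huv h => ?_⟩
  · rw [key u v h.ne]
    have : {x | G.Adj u v ∧ ∃ i : Fin m, s((u, i), (v, i)) = x} =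
        Set.range (fun i : Fin m => s((u, i), (v, i))) := by
      ext x; simp [h]
    rw [this, ← Set.image_univ, Set.ncard_image_of_injective, Set.ncard_univ, Nat.card_fin]
    intro i j hij
    rcases Sym2.eq_iff.1 hij with ⟨h1, -⟩ | ⟨h1, -⟩ <;> exact congrArg Prod.snd h1
  · rw [key u v huv]
    simp [h]

theorem fullCoverCounts_bddAbove {V : Type u} [Fintype V] (G : SimpleGraph V) (m : ℕ) :
    BddAbove (fullCoverCounts G m) := by
  classical
  refine ⟨2 ^ (Fintype.card V * m), ?_⟩
  rintro k ⟨W, C, hC, rfl⟩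
  have hu : ∀ w : W, w ∈ Finset.univ.biUnion C.L := fun w => by
    obtain ⟨u, hu⟩ := C.L_covers w
    exact Finset.mem_biUnion.2 ⟨u, Finset.mem_univ _, hu⟩
  have hsub : C.colorings ⊆ ((Finset.univ.biUnion C.L).powerset : Set (Finset W)) := by
    intro I _
    simp only [Finset.coe_powerset, Set.mem_preimage, Set.mem_powerset_iff]
    exact fun w _ => hu w
  calc C.count ≤ ((Finset.univ.biUnion C.L).powerset : Set (Finset W)).ncard :=
        Set.ncard_le_ncard hsub (Finset.finite_toSet _)
    _ = 2 ^ (Finset.univ.biUnion C.L).card := by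
        rw [Set.ncard_coe_finset, Finset.card_powerset]
    _ ≤ 2 ^ (Fintype.card V * m) := by
        apply Nat.pow_le_pow_right (by norm_num)
        exact Finset.card_biUnion_le_card_mul _ _ _ fun u _ => (hC.1 u).le

theorem dualDPColor_isGreatest {V : Type u} [Fintype V] (G : SimpleGraph V) (m : ℕ)
    (hm : 0 < m) : IsGreatest (fullCoverCounts G m) (dualDPColor G m) :=
  ⟨Nat.sSup_mem ⟨_, _, canonicalCover G m hm, canonicalCover_isFull G m hm, rfl⟩
      (fullCoverCounts_bddAbove G m),
    fun _ hk => le_csSup (fullCoverCounts_bddAbove G m) hk⟩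

/-!
In coordinates on the lists, a full `m`-fold cover is a system of permutations of `m` colors, one
for each edge, and its colorings are the maps `V → Fin m` with no edge monochromatic in the twisted
sense given by the permutations. Inclusion–exclusion over edge sets (`ncard_unmatchedMaps_eq_sum`)
writes their number as `∑ A, (-1) ^ |A| * N A`, where `N A` counts the maps with all edges of `A`
monochromatic. For the identity permutations the sum is `P(G, m)`.

The two sums are compared term by term. No system has a larger `N A` than the identity system, as
one sees on a spanning forest (`IsMatchingSystem.ncard_matchedMaps_le`), and the two values agree
if `A` is acyclic, since then all permutations can be removed by relabelling the colors
(`IsMatchingSystem.exists_relabelling`). So the terms with `|A|` even contribute at most zero to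
the difference, and only the sets `A` of odd size that contain a cycle can contribute positively.
Let `k = g - 1`, an even number. A `k`-cycle alone has an even number of edges, so such an `A`
contains a longer cycle, or a `k`-cycle and a further edge, which is not a chord by the girth
condition. In both cases `A` determines the colors of `k` vertices from the remaining ones, and
`N A ≤ m ^ (n - k)` for the identity system (`ncard_matchedMaps_le_of_odd`). Summing over `A` gives
the upper bound `2 ^ |E| * m ^ (n - k)`. The difference is nonnegative because the cover by identity
matchings has at least `P(G, m)` colorings (`chromaticCount_le_count_canonicalCover`).
-/

/-- A system of perfect matchings over `G` on the colors `K`: for each edge `uv` of `G`, the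
relation `B u v` is the graph of a permutation of `K`, and `B v u` is the converse relation.
Off the edges of `G` only the symmetry is required. -/
structure IsMatchingSystem {V K : Type*} (G : SimpleGraph V) (B : V → V → K → K → Prop) :
    Prop where
  symm : ∀ u v i j, B u v i j → B v u j i
  exists_perm : ∀ u v, G.Adj u v → ∃ σ : Equiv.Perm K, ∀ i j, B u v i j ↔ σ i = j

/-- The maps `V → K` that make every edge of `F` monochromatic with respect to `B`. -/
def matchedMaps {V K : Type*} (B : V → V → K → K → Prop) (F : SimpleGraph V) : Set (V → K) :=
  {f | ∀ u v, F.Adj u v → B u v (f u) (f v)}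

/-- The maps `V → K` that make no edge of `G` monochromatic with respect to `B`. -/
def unmatchedMaps {V K : Type*} (B : V → V → K → K → Prop) (G : SimpleGraph V) : Set (V → K) :=
  {f | ∀ u v, G.Adj u v → ¬ B u v (f u) (f v)}

/-- The matching system in which each color is matched with itself. -/
abbrev eqSystem (V K : Type*) : V → V → K → K → Prop := fun _ _ i j => i = j

theorem isMatchingSystem_eqSystem {V K : Type*} (G : SimpleGraph V) :
    IsMatchingSystem G (eqSystem V K) :=
  ⟨fun _ _ _ _ h => h.symm, fun _ _ _ => ⟨1, fun _ _ => Iff.rfl⟩⟩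

/-! ### Inclusion–exclusion -/

theorem ncard_unmatchedMaps_eq_sum {V K : Type*} [Fintype V] [Fintype K] {G : SimpleGraph V}
    [Fintype G.edgeSet] {B : V → V → K → K → Prop} (hB : ∀ u v i j, B u v i j → B v u j i) :
    ((unmatchedMaps B G).ncard : ℤ) = ∑ A ∈ G.edgeFinset.powerset,
      (-1 : ℤ) ^ A.card * (matchedMaps B (SimpleGraph.fromEdgeSet (A : Set (Sym2 V)))).ncard := by
  classical
  let S : Sym2 V → Finset (V → K) := fun e =>
    Finset.univ.filter fun f => ∀ u v, e = s(u, v) → B u v (f u) (f v)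
  have hS : ∀ u v f, f ∈ S s(u, v) ↔ B u v (f u) (f v) := by
    intro u v f
    simp only [S, Finset.mem_filter, Finset.mem_univ, true_and]
    refine ⟨fun h => h u v rfl, fun h a b hab => ?_⟩
    rcases Sym2.eq_iff.1 hab with ⟨rfl, rfl⟩ | ⟨rfl, rfl⟩
    · exact h
    · exact hB _ _ _ _ h
  have h1 : unmatchedMaps B G = (G.edgeFinset.inf fun e => (S e)ᶜ : Finset (V → K)) := by
    ext f
    simp only [unmatchedMaps, Set.mem_ofPred_eq, Finset.mem_coe, Finset.mem_inf,
      Finset.mem_compl, SimpleGraph.mem_edgeFinset, Sym2.forall, hS, SimpleGraph.mem_edgeSet]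
  have h2 : ∀ A ∈ G.edgeFinset.powerset,
      matchedMaps B (SimpleGraph.fromEdgeSet (A : Set (Sym2 V))) = (A.inf S : Finset (V → K)) := by
    intro A hA
    ext f
    simp only [matchedMaps, Set.mem_ofPred_eq, Finset.mem_coe, Finset.mem_inf,
      SimpleGraph.fromEdgeSet_adj, Sym2.forall, hS]
    refine ⟨fun h u v huv => h u v ⟨huv, ?_⟩, fun h u v huv => h u v huv.1⟩
    exact G.ne_of_adj (SimpleGraph.mem_edgeFinset.1 (Finset.mem_powerset.1 hA huv))
  rw [h1, Set.ncard_coe_finset, Finset.inclusion_exclusion_card_inf_compl]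
  refine Finset.sum_congr rfl fun A hA => ?_
  rw [h2 A hA, Set.ncard_coe_finset]

/-! ### Trivializing a matching system on a forest -/

/-- On a forest, relabelling the colors at each vertex turns every matching into the identity
matching: when an edge `uv` is added to the forest, the labels on the whole component of `v` are
composed with the permutation that repairs `uv`. -/
theorem IsMatchingSystem.exists_relabelling {V K : Type*} {G : SimpleGraph V}
    {B : V → V → K → K → Prop} (hB : IsMatchingSystem G B) (A : Finset (Sym2 V))
    (hA : (A : Set (Sym2 V)) ⊆ G.edgeSet)
    (hac : (SimpleGraph.fromEdgeSet (A : Set (Sym2 V))).IsAcyclic) :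
    ∃ τ : V → Equiv.Perm K, ∀ u v, s(u, v) ∈ A → ∀ i j, B u v i j ↔ τ u i = τ v j := by
  classical
  induction A using Finset.induction_on with
  | empty => exact ⟨fun _ => 1, by simp⟩
  | insert e A he ih =>
    induction e with | _ u v
    set F := SimpleGraph.fromEdgeSet (A : Set (Sym2 V)) with hF
    have huv : G.Adj u v := hA (Finset.mem_insert_self s(u, v) A)
    have hins : SimpleGraph.fromEdgeSet ((insert s(u, v) A : Finset (Sym2 V)) : Set (Sym2 V)) =
        F ⊔ SimpleGraph.edge u v := by
      ext a b
      simp only [hF, SimpleGraph.fromEdgeSet_adj, SimpleGraph.sup_adj, SimpleGraph.edge,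
        Finset.coe_insert, Set.mem_insert_iff, Set.mem_singleton_iff]
      tauto
    rw [hins, SimpleGraph.isAcyclic_sup_fromEdgeSet_iff] at hac
    obtain ⟨hac, hr⟩ := hac
    have hnr : ¬ F.Reachable u v := by
      intro h
      rcases hr h with h | h
      · exact huv.ne h
      · exact he h.1
    obtain ⟨τ, hτ⟩ := ih (fun x hx => hA (by simp [Finset.mem_coe.1 hx])) hac
    obtain ⟨σ, hσ⟩ := hB.exists_perm u v huv
    let ρ : Equiv.Perm K := (τ v).symm.trans (σ.symm.trans (τ u))
    let τ' : V → Equiv.Perm K := fun w => if F.Reachable v w then (τ w).trans ρ else τ w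
    have hu : τ' u = τ u := if_neg fun h => hnr h.symm
    have hv : τ' v = (τ v).trans ρ := if_pos (SimpleGraph.Reachable.refl v)
    have key : ∀ i j, B u v i j ↔ τ' u i = τ' v j := by
      intro i j
      rw [hu, hv, hσ]
      simp only [ρ, Equiv.trans_apply, Equiv.symm_apply_apply, EmbeddingLike.apply_eq_iff_eq]
      exact ⟨fun h => by simp [← h], fun h => by simp [h]⟩
    refine ⟨τ', fun a b hab i j => ?_⟩
    rcases Finset.mem_insert.1 hab with hab | hab
    · rcases Sym2.eq_iff.1 hab with ⟨rfl, rfl⟩ | ⟨rfl, rfl⟩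
      · exact key i j
      · exact ⟨fun h => ((key j i).1 (hB.symm _ _ _ _ h)).symm,
          fun h => hB.symm _ _ _ _ ((key j i).2 h.symm)⟩
    · have hadj : F.Adj a b :=
        ⟨hab, G.ne_of_adj (hA (Finset.mem_insert_of_mem (b := s(u, v)) hab))⟩
      rw [hτ a b hab]
      have hiff : F.Reachable v a ↔ F.Reachable v b :=
        ⟨fun h => h.trans hadj.reachable, fun h => h.trans hadj.reachable.symm⟩
      by_cases h : F.Reachable v a
      · simp [τ', h, hiff.1 h]
      · simp [τ', h, mt hiff.2 h]

theorem IsMatchingSystem.ncard_matchedMaps_of_isAcyclic {V K : Type*} [Finite V] [Finite K]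
    {G F : SimpleGraph V} {B : V → V → K → K → Prop} (hB : IsMatchingSystem G B) (hF : F ≤ G)
    (hac : F.IsAcyclic) : (matchedMaps B F).ncard = (matchedMaps (eqSystem V K) F).ncard := by
  classical
  have := Fintype.ofFinite V
  obtain ⟨τ, hτ⟩ := hB.exists_relabelling F.edgeFinset
    (by simpa using hF) (by simpa using hac)
  have himage : Equiv.piCongrRight τ '' matchedMaps B F = matchedMaps (eqSystem V K) F := by
    rw [Equiv.image_eq_preimage_symm]
    ext f
    simp only [matchedMaps, Set.mem_preimage, Set.mem_ofPred_eq]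
    refine forall₃_congr fun u v huv => ?_
    rw [hτ u v (by simpa using huv)]
    simp
  rw [← himage, Set.ncard_image_of_injective _ (Equiv.injective _)]

theorem eq_of_mem_matchedMaps_of_reachable {V K : Type*} {F : SimpleGraph V} {f : V → K}
    (hf : f ∈ matchedMaps (eqSystem V K) F) {u v : V} (h : F.Reachable u v) : f u = f v := by
  obtain ⟨p⟩ := h
  induction p with
  | nil => rfl
  | cons hadj _ ih => exact (hf _ _ hadj).trans ih

/-- No matching system has more maps that are monochromatic on `F` than the trivial one: pass to
a spanning forest, which only relaxes the condition for `B` and does not change it for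
`eqSystem`. -/
theorem IsMatchingSystem.ncard_matchedMaps_le {V K : Type*} [Finite V] [Finite K]
    {G F : SimpleGraph V} {B : V → V → K → K → Prop} (hB : IsMatchingSystem G B) (hF : F ≤ G) :
    (matchedMaps B F).ncard ≤ (matchedMaps (eqSystem V K) F).ncard := by
  obtain ⟨T, hTF, hT, hreach⟩ := F.exists_isAcyclic_reachable_eq_le
  calc (matchedMaps B F).ncard ≤ (matchedMaps B T).ncard :=
        Set.ncard_le_ncard (fun f hf u v huv => hf u v (hTF huv)) (Set.toFinite _)
    _ = (matchedMaps (eqSystem V K) T).ncard :=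
        hB.ncard_matchedMaps_of_isAcyclic (hTF.trans hF) hT
    _ ≤ (matchedMaps (eqSystem V K) F).ncard := by
        refine Set.ncard_le_ncard (fun f hf u v huv => ?_) (Set.toFinite _)
        exact eq_of_mem_matchedMaps_of_reachable hf (hreach ▸ huv.reachable)

/-! ### Cyclic edge sets of odd size -/

/-- Each vertex of `S` is redundant: its color is forced by the colors outside `S`. -/
theorem ncard_le_pow_of_injOn_compl {V K : Type*} [Fintype V] [Fintype K] (S : Finset V)
    (X : Set (V → K)) (h : ∀ f ∈ X, ∀ f' ∈ X, (∀ v ∉ S, f v = f' v) → f = f') :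
    X.ncard ≤ Fintype.card K ^ (Fintype.card V - S.card) := by
  classical
  let r : (V → K) → ({v // v ∉ S} → K) := fun f v => f v
  have hr : Set.InjOn r X := fun f hf f' hf' hff => h f hf f' hf' fun v hv =>
    congrFun hff ⟨v, hv⟩
  calc X.ncard = (r '' X).ncard := hr.ncard_image.symm
    _ ≤ Nat.card ({v // v ∉ S} → K) := Set.ncard_le_card _
    _ = _ := by
      rw [Nat.card_eq_fintype_card, Fintype.card_fun, Fintype.card_subtype_compl]
      simp

/-- The vertices of a cycle other than its base point: one fewer than its length. -/
theorem exists_finset_of_isCycle {V : Type*} {F : SimpleGraph V} {a : V}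
    {c : F.Walk a a} (hc : c.IsCycle) :
    ∃ S : Finset V, a ∉ S ∧ (∀ v ∈ S, v ∈ c.support) ∧ S.card + 1 = c.length := by
  classical
  refine ⟨c.support.tail.toFinset.erase a, by simp, fun v hv => ?_, ?_⟩
  · exact List.mem_of_mem_tail (List.mem_toFinset.1 (Finset.mem_of_mem_erase hv))
  · rw [Finset.card_erase_add_one
      (List.mem_toFinset.2 (c.end_mem_tail_support hc.not_nil)),
      List.toFinset_card_of_nodup hc.support_nodup]
    simp

/-- A chord splits a cycle into two cycles whose lengths add up to two more, so the shorter one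
violates the girth bound unless the cycle is long. -/
theorem SimpleGraph.Walk.IsCycle.two_mul_le_length_add_two_of_chord {V : Type*}
    {F : SimpleGraph V} {k : ℕ} (hk : ∀ a (w : F.Walk a a), w.IsCycle → k ≤ w.length)
    {a x y : V} {c : F.Walk a a} (hc : c.IsCycle) (hxy : F.Adj x y) (hx : x ∈ c.support)
    (hy : y ∈ c.support) (he : s(x, y) ∉ c.edges) : 2 * k ≤ c.length + 2 := by
  classical
  have hc' := hc.rotate hx
  set d := c.rotate x hx with hd
  have hde : s(x, y) ∉ d.edges := fun h => he ((c.rotate_edges x hx).perm.mem_iff.1 h)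
  have hyd : y ∈ d.support := (SimpleGraph.Walk.mem_support_rotate_iff c x hx).2 hy
  have hlen : d.length = c.length := by simp [hd]
  have hspec := congrArg SimpleGraph.Walk.length (d.take_spec hyd)
  rw [SimpleGraph.Walk.length_append] at hspec
  have h1 := hk _ (.cons hxy.symm (d.takeUntil y hyd)) <| by
    rw [SimpleGraph.Walk.cons_isCycle_iff, Sym2.eq_swap]
    exact ⟨hc'.isPath_takeUntil hyd, fun h => hde (d.edges_takeUntil_subset_edges hyd h)⟩
  have h2 := hk _ (.cons hxy (d.dropUntil y hyd)) <| by
    rw [SimpleGraph.Walk.cons_isCycle_iff]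
    refine ⟨?_, fun h => hde (d.edges_dropUntil_subset_edges hyd h)⟩
    refine SimpleGraph.Walk.IsCycle.isPath_of_append_right (p := d.takeUntil y hyd)
      (SimpleGraph.Walk.not_nil_of_ne hxy.ne) ?_
    rwa [d.take_spec hyd]
  simp only [SimpleGraph.Walk.length_cons] at h1 h2
  omega

/-- If all cycles have length at least `k`, with `k` even, then an edge set of odd size that
contains a cycle forces the colors of `k` vertices. Either the cycle has more than `k` vertices,
or the odd edge set has an edge off that cycle, which is not a chord and so has an endpoint
outside. -/
theorem ncard_matchedMaps_le_of_odd {V K : Type*} [Fintype V] [Fintype K] (A : Finset (Sym2 V))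
    {k : ℕ} (hk : Even k) (hA : Odd A.card) (hd : ∀ e ∈ A, ¬ e.IsDiag)
    (hgirth : ∀ a (w : (SimpleGraph.fromEdgeSet (A : Set (Sym2 V))).Walk a a),
      w.IsCycle → k ≤ w.length)
    (hcyc : ¬ (SimpleGraph.fromEdgeSet (A : Set (Sym2 V))).IsAcyclic) :
    k ≤ Fintype.card V ∧
      (matchedMaps (eqSystem V K) (SimpleGraph.fromEdgeSet (A : Set (Sym2 V)))).ncard ≤
        Fintype.card K ^ (Fintype.card V - k) := by
  classical
  set F := SimpleGraph.fromEdgeSet (A : Set (Sym2 V)) with hF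
  suffices h : ∃ S : Finset V, S.card = k ∧ ∀ f ∈ matchedMaps (eqSystem V K) F,
      ∀ f' ∈ matchedMaps (eqSystem V K) F, (∀ v ∉ S, f v = f' v) → f = f' by
    obtain ⟨S, rfl, h⟩ := h
    exact ⟨S.card_le_univ, ncard_le_pow_of_injOn_compl S _ h⟩
  obtain ⟨a, c, hc⟩ : ∃ a, ∃ c : F.Walk a a, c.IsCycle := by
    simpa [SimpleGraph.IsAcyclic] using hcyc
  have hconst : ∀ f ∈ matchedMaps (eqSystem V K) F, ∀ v ∈ c.support, f v = f a :=
    fun f hf v hv => eq_of_mem_matchedMaps_of_reachable hf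
      (c.takeUntil v hv).reachable.symm
  obtain ⟨S, haS, hSc, hcard⟩ := exists_finset_of_isCycle hc
  rcases (hgirth a c hc).lt_or_eq with hlt | heq
  · obtain ⟨T, hTS, hT⟩ := Finset.exists_subset_card_eq (show k ≤ S.card by omega)
    refine ⟨T, hT, fun f hf f' hf' hff => funext fun v => ?_⟩
    by_cases hv : v ∈ T
    · have := hSc v (hTS hv)
      rw [hconst f hf v this, hconst f' hf' v this]
      exact hff a fun h => haS (hTS h)
    · exact hff v hv
  · have hedges : c.edges.toFinset.card = k := by
      rw [List.toFinset_card_of_nodup hc.isTrail.edges_nodup, c.length_edges, heq]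
    -- `c` has an even number of edges, so it does not exhaust `A`.
    obtain ⟨e, heA, hec⟩ : ∃ e ∈ A, e ∉ c.edges := by
      by_contra! h
      have hEq : A = c.edges.toFinset := by
        refine Finset.Subset.antisymm (fun e he => List.mem_toFinset.2 (h e he)) fun e he => ?_
        have := c.edges_subset_edgeSet (List.mem_toFinset.1 he)
        rw [hF, SimpleGraph.edgeSet_fromEdgeSet] at this
        exact this.1
      rw [hEq, hedges] at hA
      exact Nat.not_even_iff_odd.2 hA hk
    obtain ⟨x, y, rfl, hy⟩ : ∃ x y, e = s(x, y) ∧ y ∉ c.support := by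
      induction e with | _ x y
      by_cases hy : y ∈ c.support
      · refine ⟨y, x, Sym2.eq_swap, fun hx => ?_⟩
        have hadj : F.Adj x y := ⟨heA, fun h => hd _ heA (by simpa using h)⟩
        have := hc.two_mul_le_length_add_two_of_chord hgirth hadj hx hy hec
        have := hc.three_le_length
        omega
      · exact ⟨x, y, rfl, hy⟩
    have hadj : F.Adj x y := ⟨heA, fun h => hd _ heA (by simpa using h)⟩
    refine ⟨insert y S, ?_, fun f hf f' hf' hff => ?_⟩
    · rw [Finset.card_insert_of_notMem fun h => hy (hSc y h)]
      omega
    · have ha : f a = f' a := hff a fun h => (Finset.mem_insert.1 h).elim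
        (fun h => hy (h ▸ c.start_mem_support)) haS
      have hne : ∀ v, v ≠ y → f v = f' v := by
        intro v hv
        by_cases hvS : v ∈ S
        · rw [hconst f hf v (hSc v hvS), hconst f' hf' v (hSc v hvS), ha]
        · exact hff v (by simp [hv, hvS])
      funext v
      by_cases hv : v = y
      · subst hv
        rw [← show f x = f v from hf x v hadj, ← show f' x = f' v from hf' x v hadj]
        exact hne x hadj.ne
      · exact hne v hv

/-! ### Comparison of matching systems -/

theorem IsMatchingSystem.ncard_unmatchedMaps_sub_le {V K : Type*} [Fintype V] [Fintype K]
    [Nonempty K] {G : SimpleGraph V} [Fintype G.edgeSet] {B : V → V → K → K → Prop}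
    (hB : IsMatchingSystem G B) {k : ℕ} (hk : Even k)
    (hgirth : (k : ℕ∞) ≤ G.egirth) :
    ((unmatchedMaps B G).ncard : ℝ) - (unmatchedMaps (eqSystem V K) G).ncard ≤
      2 ^ G.edgeFinset.card * (Fintype.card K : ℝ) ^ ((Fintype.card V : ℤ) - k) := by
  classical
  have h1 := ncard_unmatchedMaps_eq_sum (G := G) hB.symm
  have h2 := ncard_unmatchedMaps_eq_sum (G := G) (isMatchingSystem_eqSystem (K := K) G).symm
  have h1' := congrArg (Int.cast : ℤ → ℝ) h1
  have h2' := congrArg (Int.cast : ℤ → ℝ) h2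
  push_cast at h1' h2'
  rw [h1', h2', ← Finset.sum_sub_distrib]
  have hpos : (0 : ℝ) ≤ (Fintype.card K : ℝ) ^ ((Fintype.card V : ℤ) - k) := by positivity
  calc _ ≤ ∑ A ∈ G.edgeFinset.powerset, (Fintype.card K : ℝ) ^ ((Fintype.card V : ℤ) - k) := ?_
    _ = _ := by simp [Finset.card_powerset]
  refine Finset.sum_le_sum fun A hA => ?_
  have hAG : ∀ e ∈ A, e ∈ G.edgeSet := fun e he =>
    SimpleGraph.mem_edgeFinset.1 (Finset.mem_powerset.1 hA he)
  set F := SimpleGraph.fromEdgeSet (A : Set (Sym2 V)) with hF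
  have hFG : F ≤ G := fun u v h => hAG _ h.1
  have hle : ((matchedMaps B F).ncard : ℝ) ≤ (matchedMaps (eqSystem V K) F).ncard := by
    exact_mod_cast hB.ncard_matchedMaps_le hFG
  rw [← mul_sub]
  rcases Nat.even_or_odd A.card with hev | hodd
  · rw [hev.neg_one_pow]
    linarith
  · rw [hodd.neg_one_pow]
    by_cases hac : F.IsAcyclic
    · rw [hB.ncard_matchedMaps_of_isAcyclic hFG hac]
      simpa using hpos
    · obtain ⟨hkV, hN⟩ := ncard_matchedMaps_le_of_odd (K := K) A hk hodd
        (fun e he => G.not_isDiag_of_mem_edgeSet (hAG e he))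
        (fun a w hw => by
          have := SimpleGraph.le_egirth.1 (hgirth.trans (SimpleGraph.egirth_anti hFG)) a w hw
          exact_mod_cast this) hac
      have hN' : ((matchedMaps (eqSystem V K) F).ncard : ℝ) ≤
          (Fintype.card K : ℝ) ^ ((Fintype.card V : ℤ) - k) := by
        rw [← Nat.cast_sub hkV, zpow_natCast]
        exact_mod_cast hN
      have : (0 : ℝ) ≤ (matchedMaps B F).ncard := by positivity
      linarith

/-! ### Full covers as matching systems -/

namespace DPCover

theorem edgesBetween_subset {V W : Type u} {G : SimpleGraph V} (C : DPCover G W) {u v : V}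
    (huv : G.Adj u v) : edgesBetween C.H (C.L u) (C.L v) ⊆ C.M ⟨s(u, v), huv⟩ := by
  rw [C.edges_eq u v huv.ne]
  exact Set.iUnion_subset fun _ => subset_rfl

/-- The `m` edges of the matching between two lists of size `m` saturate both lists. -/
theorem IsFull.exists_adj {V W : Type u} {G : SimpleGraph V} {C : DPCover G W} {m : ℕ}
    (hC : C.IsFull m) {u v : V} (huv : G.Adj u v) {a : W} (ha : a ∈ C.L u) :
    ∃ b ∈ C.L v, C.H.Adj a b := by
  classical
  let E := edgesBetween C.H (C.L u) (C.L v)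
  have hE : E ⊆ C.M ⟨s(u, v), huv⟩ := C.edgesBetween_subset huv
  have : Nonempty W := ⟨a⟩
  choose! p hpL q hqL hadj hpq using fun x (hx : x ∈ E) => hx
  have hinj : Set.InjOn p E := fun x hx y hy hxy => by
    refine C.M_matching _ x (hE hx) y (hE hy) (p x) ?_ ?_
    · exact Sym2.mem_iff_exists.2 ⟨q x, hpq x hx⟩
    · rw [hxy]
      exact Sym2.mem_iff_exists.2 ⟨q y, hpq y hy⟩
  have himage : p '' E = C.L u := by
    refine Set.eq_of_subset_of_ncard_le ?_ ?_ (Finset.finite_toSet _)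
    · rintro _ ⟨x, hx, rfl⟩
      exact hpL x hx
    · rw [hinj.ncard_image, Set.ncard_coe_finset, hC.1 u, hC.2.1 u v huv]
  obtain ⟨x, hx, rfl⟩ : a ∈ p '' E := by rw [himage]; exact ha
  exact ⟨q x, hqL x hx, hadj x hx⟩

theorem eq_of_adj_of_adj {V W : Type u} {G : SimpleGraph V} (C : DPCover G W) {u v : V}
    (huv : G.Adj u v) {a b b' : W} (ha : a ∈ C.L u) (hb : b ∈ C.L v) (hb' : b' ∈ C.L v)
    (h : C.H.Adj a b) (h' : C.H.Adj a b') : b = b' := by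
  have hE : ∀ c ∈ C.L v, C.H.Adj a c → s(a, c) ∈ C.M ⟨s(u, v), huv⟩ :=
    fun c hc hac => C.edgesBetween_subset huv ⟨a, ha, c, hc, hac, rfl⟩
  have := C.M_matching _ _ (hE b hb h) _ (hE b' hb' h') a (by simp) (by simp)
  exact Sym2.congr_right.1 this

/-- The matching system of a full cover, in coordinates `e u` on the lists. -/
theorem IsFull.isMatchingSystem {V W : Type u} {G : SimpleGraph V} {C : DPCover G W} {m : ℕ}
    (hC : C.IsFull m) (e : ∀ u, C.L u ≃ Fin m) :
    IsMatchingSystem G fun u v i j => C.H.Adj ((e u).symm i : W) ((e v).symm j : W) := by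
  refine ⟨fun u v i j h => h.symm, fun u v huv => ?_⟩
  choose b hb hab using fun i => hC.exists_adj huv ((e u).symm i).2
  let σ : Fin m → Fin m := fun i => e v ⟨b i, hb i⟩
  have hσ : ∀ i j, C.H.Adj ((e u).symm i : W) ((e v).symm j : W) ↔ σ i = j := by
    intro i j
    constructor
    · intro h
      have := C.eq_of_adj_of_adj huv ((e u).symm i).2 (hb i) ((e v).symm j).2 (hab i) h
      simp [σ, this]
    · rintro rfl
      simpa [σ] using hab i
  have hinj : Function.Injective σ := by
    intro i i' hii
    have h := ((hσ i _).2 hii).symm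
    have h' := ((hσ i' _).2 rfl).symm
    have := C.eq_of_adj_of_adj huv.symm ((e v).symm _).2 ((e u).symm i).2 ((e u).symm i').2 h h'
    exact (e u).symm.injective (Subtype.ext this)
  exact ⟨Equiv.ofBijective σ (Finite.injective_iff_bijective.1 hinj), hσ⟩

/-- An independent set of size `|V(G)|` meets each list: the lists are cliques that cover `H`. -/
theorem exists_mem_of_mem_colorings {V W : Type u} [Fintype V] {G : SimpleGraph V}
    (C : DPCover G W) {I : Finset W} (hI : I ∈ C.colorings) (u : V) : ∃ w ∈ I, w ∈ C.L u := by
  choose p hp using C.L_covers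
  have hinj : Set.InjOn p I := by
    intro w hw w' hw' hww
    by_contra hne
    exact hI.1 hw hw' hne (C.L_clique (p w) (hp w) (by rw [hww]; exact hp w') hne)
  have hmaps : Set.MapsTo p I (Finset.univ : Finset V) := fun w _ => by simp
  obtain ⟨w, hw, rfl⟩ := Finset.surjOn_of_injOn_of_card_le p hmaps hinj
    (by rw [hI.2, Finset.card_univ]) (Finset.mem_coe.2 (Finset.mem_univ u))
  exact ⟨w, hw, hp w⟩

theorem count_le_ncard_unmatchedMaps {V W : Type u} [Fintype V] {G : SimpleGraph V}
    (C : DPCover G W) {m : ℕ} (e : ∀ u, C.L u ≃ Fin m) :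
    C.count ≤ (unmatchedMaps
      (fun u v i j => C.H.Adj ((e u).symm i : W) ((e v).symm j : W)) G).ncard := by
  classical
  have hex : ∀ I ∈ C.colorings, ∃ w : V → W, (∀ u, w u ∈ I) ∧ ∀ u, w u ∈ C.L u := by
    intro I hI
    choose w hwI hwL using C.exists_mem_of_mem_colorings hI
    exact ⟨w, hwI, hwL⟩
  have : Nonempty (V → W) := ⟨fun u => (C.L_nonempty u).choose⟩
  choose! w hwI hwL using hex
  have hwinj : ∀ I ∈ C.colorings, Function.Injective (w I) := by
    intro I hI u v huv
    by_contra hne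
    exact Finset.disjoint_left.1 (C.L_disjoint u v hne) (hwL I hI u) (huv ▸ hwL I hI v)
  have himage : ∀ I ∈ C.colorings, Finset.univ.image (w I) = I := by
    intro I hI
    refine Finset.eq_of_subset_of_card_le ?_ ?_
    · intro x hx
      obtain ⟨u, -, rfl⟩ := Finset.mem_image.1 hx
      exact hwI I hI u
    · rw [Finset.card_image_of_injective _ (hwinj I hI), hI.2, Finset.card_univ]
  -- Only the first branch is used on colorings.
  refine Set.ncard_le_ncard_of_injOn
    (fun I u => if h : w I u ∈ C.L u then e u ⟨w I u, h⟩
      else e u ⟨_, (C.L_nonempty u).choose_spec⟩)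
    ?_ ?_ (Set.toFinite _)
  · intro I hI u v huv hadj
    simp only [dif_pos (hwL I hI u), dif_pos (hwL I hI v), Equiv.symm_apply_apply] at hadj
    exact hI.1 (hwI I hI u) (hwI I hI v) hadj.ne hadj
  · intro I hI J hJ hIJ
    rw [← himage I hI, ← himage J hJ]
    congr 1
    funext u
    have := congrFun hIJ u
    simpa only [dif_pos (hwL I hI u), dif_pos (hwL J hJ u), EmbeddingLike.apply_eq_iff_eq,
      Subtype.mk.injEq] using this

end DPCover

theorem ncard_unmatchedMaps_eqSystem {V : Type u} (G : SimpleGraph V) (m : ℕ) :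
    (unmatchedMaps (eqSystem V (Fin m)) G).ncard = chromaticCount G m := by
  rw [chromaticCount, ← Nat.card_coe_set_eq]
  refine Nat.card_congr ⟨fun f => SimpleGraph.Coloring.mk f.1 fun {u v} h => f.2 u v h,
    fun c => ⟨c, fun u v h => c.valid h⟩, fun f => rfl, fun c => rfl⟩

/-- A proper coloring is an independent set of the cover by identity matchings, namely its
graph. -/
theorem chromaticCount_le_count_canonicalCover {V : Type u} [Fintype V] (G : SimpleGraph V)
    (m : ℕ) (hm : 0 < m) : chromaticCount G m ≤ (canonicalCover G m hm).count := by
  classical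
  rw [← ncard_unmatchedMaps_eqSystem]
  refine Set.ncard_le_ncard_of_injOn (fun f => Finset.univ.image fun u => (u, f u)) ?_ ?_
    (Set.toFinite _)
  · intro f hf
    refine ⟨?_, ?_⟩
    · intro x hx y hy _ hadj
      simp only [Finset.coe_image, Finset.coe_univ, Set.image_univ, Set.mem_range] at hx hy
      obtain ⟨u, rfl⟩ := hx
      obtain ⟨v, rfl⟩ := hy
      rcases hadj with ⟨h, h'⟩ | ⟨h, h'⟩
      · exact h' (congrArg f h)
      · exact hf u v h h'
    · rw [Finset.card_image_of_injective _ fun u v h => congrArg Prod.fst h, Finset.card_univ]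
  · intro f _ f' _ h
    funext u
    have hu : (u, f u) ∈ Finset.univ.image fun u => (u, f' u) := by
      rw [← show _ = Finset.univ.image fun u => (u, f' u) from h]
      simp
    simpa [eq_comm] using hu

theorem mainTheorem2 {V : Type u} [Fintype V] (G : SimpleGraph V) (g : ℕ) (hodd : Odd g)
    (hg : 3 ≤ g) (hgirth : ((g - 1 : ℕ) : ℕ∞) ≤ G.egirth) :
    (fun m : ℕ => (dualDPColor G m : ℝ) - (chromaticCount G m : ℝ)) =O[atTop]
      (fun m : ℕ => (m : ℝ) ^ ((Fintype.card V : ℤ) - (g : ℤ) + 1)) := by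
  classical
  refine IsBigO.of_bound (2 ^ G.edgeFinset.card) ?_
  filter_upwards [eventually_gt_atTop 0] with m hm
  have : Nonempty (Fin m) := ⟨⟨0, hm⟩⟩
  have hlow : (chromaticCount G m : ℝ) ≤ dualDPColor G m := by
    exact_mod_cast (chromaticCount_le_count_canonicalCover G m hm).trans
      ((dualDPColor_isGreatest G m hm).2 ⟨_, _, canonicalCover_isFull G m hm, rfl⟩)
  obtain ⟨W, C, hC, hcount⟩ := (dualDPColor_isGreatest G m hm).1
  let e : ∀ u, C.L u ≃ Fin m := fun u => (C.L u).equivFinOfCardEq (hC.1 u)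
  have hup : (dualDPColor G m : ℝ) ≤ (unmatchedMaps
      (fun u v i j => C.H.Adj ((e u).symm i : W) ((e v).symm j : W)) G).ncard := by
    rw [← hcount]
    exact_mod_cast C.count_le_ncard_unmatchedMaps e
  have hmain := (hC.isMatchingSystem e).ncard_unmatchedMaps_sub_le (Nat.Odd.sub_odd hodd odd_one)
    hgirth
  rw [ncard_unmatchedMaps_eqSystem, Fintype.card_fin] at hmain
  have hexp : (Fintype.card V : ℤ) - ((g - 1 : ℕ) : ℤ) = (Fintype.card V : ℤ) - g + 1 := by
    omega
  rw [hexp] at hmain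
  rw [Real.norm_of_nonneg (sub_nonneg.2 hlow), Real.norm_of_nonneg (by positivity)]
  linarith
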